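/- Let $\mathcal K_{\mathrm{IV}}$ be the class of locally compact Hausdorff spaces $P$ such that for every $\sigma$-compact $S\subseteq P$ the complement $P\setminus S$ has an interior point and the point $p_\infty$ of the one-point compactification $\alpha P=P\cup\{p_\infty\}$ is an interior point of $\alpha P\setminus S$ (equivalently, $P$ is not compact and every $\sigma$-compact subset of $P$ has compact closure). Let $P\in\mathcal K_{\mathrm{IV}}$, let $[0,\omega_0]$ be the space of ordinals $\le\omega_0$ with the order topology, and put $$K=(\alpha P\times[0,\omega_0])\setminus\{(p_\infty,\omega_0)\}.$$ Consider $C_0(K)$ (complex-valued functions) as a Hilbert $C^*$-module over itself with $\langle x,y\rangle=\overline{x}\,y$; its multiplier module is $C_b(K)$, and $\langle x,y\rangle=\overline{x}\,y\in C_0(K)$ for $x\in C_0(K)$, $y\in C_b(K)$. A sequence $X=(x_i)_{i\ge1}$ in $C_b(K)$ is called admissible if $\|x_i\|\le1$ for all $i$ and, for every $x\in C_0(K)$, the series $\sum_i\langle x,x_i\rangle\langle x_i,x\rangle$ converges in norm in $C_0(K)$ with sum at most $\langle x,x\rangle$. For an admissible $X$ and a sequence $\Phi=(\varphi_k)_{k\ge1}$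 of states (positive linear functionals of norm $1$) on $C_0(K)$ put $$d_{X,\Phi}(x,y)=\Big(\sup_k\sum_{i=k}^\infty|\varphi_k(\langle x-y,x_i\rangle)|^2\Big)^{1/2},\qquad x,y\in C_0(K).$$ A set $Y\subseteq C_0(K)$ is $(C_b(K),C_0(K))$-totally bounded if for all such $X$, $\Phi$ and all $\varepsilon>0$ there are finitely many $y_1,\dots,y_n\in Y$ such that every $y\in Y$ satisfies $d_{X,\Phi}(y_j,y)<\varepsilon$ for some $j$; it is $(C_0(K),C_0(K))$-totally bounded if this holds for all admissible $X$ with members in $C_0(K)$. A bounded operator $F:\mathcal M\to\mathcal N$ of Hilbert $C_0(K)$-modules is $C_0(K)$-compact if it lies in the operator-norm closure of the linear span of the operators $z\mapsto x\langle y,z\rangle$, $x\in\mathcal N$, $y\in\mathcal M$. Then the closed unit ball of $C_0(K)$ is $(C_b(K),C_0(K))$-totally bounded, but the identity operator $C_0(K)\to C_0(K)$ is not $C_0(K)$-compact. Consequently Troitsky's criterion fails for the module $C_0(K)$: it is not true that an adjointable operator $F$ from a Hilbert $C_0(K)$-module $\mathcal M$ to $C_0(K)$ is always $C_0(K)$-compact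 if and only if the image under $F$ of the unit ball of $\mathcal M$ is totally bounded, whether total boundedness is understood in the $(C_b(K),C_0(K))$-sense or in the $(C_0(K),C_0(K))$-sense. -/

import Mathlib

open scoped ZeroAtInfty ComplexOrder BoundedContinuousFunction

universe u

/-! ### The spaces -/

/-- The class of locally compact Hausdorff spaces in which the complement of every σ-compact subset
has an inner point and, in the one-point compactification, the point at infinity is always inner
for that complement. (Equivalently: the space is locally compact Hausdorff, not compact, and every
σ-compact subset has compact closure.) -/
structure IsKIV (P : Type u) [TopologicalSpace P] : Prop where
  locallyCompact : LocallyCompactSpace P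
  t2 : T2Space P
  nonempty_interior_compl : ∀ S : Set P, IsSigmaCompact S → (interior Sᶜ).Nonempty
  infty_mem_interior_compl : ∀ S : Set P, IsSigmaCompact S →
    (OnePoint.infty : OnePoint P) ∈ interior (((↑) : P → OnePoint P) '' S)ᶜ

/-- The space `αP × [0, ω₀]` without its corner `(p_∞, ω₀)`. The space `[0, ω₀]` of all ordinals
`≤ ω₀` is `ℕ∞` with its order topology. -/
abbrev DeletedPlank (P : Type u) [TopologicalSpace P] : Type u :=
  {q : OnePoint P × ℕ∞ // q ≠ (OnePoint.infty, ⊤)}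

/-! ### The order of the C⋆-algebra `C₀(X)` -/

/-- The order on `C₀(X, ℂ)`: `f ≤ g` iff `g - f` is pointwise real and nonnegative. -/
noncomputable instance zeroAtInftyPartialOrder (X : Type u) [TopologicalSpace X] : PartialOrder C₀(X, ℂ) :=
  PartialOrder.lift (fun f : C₀(X, ℂ) => (f : X → ℂ)) DFunLike.coe_injective

/-- The pointwise order is the order of the C⋆-algebra `C₀(X, ℂ)`. -/
instance zeroAtInftyStarOrderedRing (X : Type u) [TopologicalSpace X] :
    StarOrderedRing C₀(X, ℂ) := by
  refine StarOrderedRing.of_nonneg_iff' (fun {x y} hxy z t => add_le_add le_rfl (hxy t))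
    (fun f => ⟨fun hf => ?_, ?_⟩)
  · refine ⟨⟨⟨fun t => ((Real.sqrt (f t).re : ℝ) : ℂ), by fun_prop⟩, ?_⟩, ?_⟩
    · have h : Filter.Tendsto (fun t => ((Real.sqrt (f t).re : ℝ) : ℂ)) (Filter.cocompact X)
          (nhds ((Real.sqrt (0 : ℂ).re : ℝ) : ℂ)) :=
        (Continuous.tendsto (by fun_prop : Continuous fun z : ℂ => ((Real.sqrt z.re : ℝ) : ℂ))
          0).comp f.zero_at_infty'
      simpa using h
    · ext t
      have ht : 0 ≤ f t := hf t
      obtain ⟨h1, h2⟩ := Complex.nonneg_iff.1 ht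
      change f t = star ((Real.sqrt (f t).re : ℝ) : ℂ) * ((Real.sqrt (f t).re : ℝ) : ℂ)
      rw [Complex.star_def, Complex.conj_ofReal, ← Complex.ofReal_mul, Real.mul_self_sqrt h1]
      exact Complex.ext rfl (by simp [← h2])
  · rintro ⟨s, rfl⟩ t
    exact star_mul_self_nonneg (s t)

noncomputable section

/-! ### Operators between Hilbert C⋆-modules -/

section Operators

variable (A : Type*) [NonUnitalCStarAlgebra A] [PartialOrder A] [StarOrderedRing A]
  {M N : Type*} [NormedAddCommGroup M] [NormedSpace ℂ M] [SMul A M] [CStarModule A M]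
  [NormedAddCommGroup N] [NormedSpace ℂ N] [SMul A N] [CStarModule A N]

/-- `F : M → N` has an adjoint with respect to the `A`-valued inner products. -/
def IsAdjointable (F : M →L[ℂ] N) : Prop :=
  ∃ G : N →L[ℂ] M, ∀ (x : M) (y : N), inner A (F x) y = inner A x (G y)

/-- The elementary `A`-compact operators `θ_{x,y} : z ↦ x⟨y, z⟩`, for `x ∈ N` and `y ∈ M`. -/
def elementaryCompact (M N : Type*) [NormedAddCommGroup M] [NormedSpace ℂ M] [SMul A M]
    [CStarModule A M] [NormedAddCommGroup N] [NormedSpace ℂ N] [SMul A N] [CStarModule A N] :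
    Set (M →L[ℂ] N) :=
  {θ | ∃ (x : N) (y : M), ∀ z : M, θ z = inner A y z • x}

/-- `F` lies in the operator-norm closure of the linear span of the elementary `A`-compact
operators. -/
def IsACompact (F : M →L[ℂ] N) : Prop :=
  F ∈ closure (Submodule.span ℂ (elementaryCompact A M N) : Set (M →L[ℂ] N))

end Operators

/-- A state: a positive linear functional of norm one. -/
structure IsState {A : Type*} [NonUnitalCStarAlgebra A] [PartialOrder A] (φ : A →L[ℂ] ℂ) :
    Prop where
  nonneg : ∀ a : A, 0 ≤ a → 0 ≤ φ a
  norm_eq_one : ‖φ‖ = 1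

/-! ### The uniform structure on `C₀(X)` -/

section Uniform

variable {X : Type u} [TopologicalSpace X]

/-- The inner product `⟨x, y⟩` of `x ∈ C₀(X)` with an element `y` of the multiplier module `C_b(X)`.
It lies in `C₀(X)`, and extends the inner product of the Hilbert `C₀(X)`-module `C₀(X)`. -/
def outerInner (x : C₀(X, ℂ)) (y : X →ᵇ ℂ) : C₀(X, ℂ) where
  toFun t := y t * star (x t)
  continuous_toFun := by fun_prop
  zero_at_infty' := by
    refine squeeze_zero_norm (a := fun t => ‖y‖ * ‖x t‖) (fun t => ?_) ?_
    · rw [norm_mul, norm_star]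
      exact mul_le_mul_of_nonneg_right (y.norm_coe_le_norm t) (norm_nonneg _)
    · simpa using (x.zero_at_infty'.norm).const_mul ‖y‖

/-- The sequence `ξ` of elements of `C_b(X)` is admissible for `C₀(X)`: for every `x ∈ C₀(X)` the
series `∑ᵢ ⟨x, ξᵢ⟩⟨ξᵢ, x⟩` converges in `C₀(X)` and its sum is at most `⟨x, x⟩`, and `‖ξᵢ‖ ≤ 1`. -/
structure IsAdmissible (ξ : ℕ → X →ᵇ ℂ) : Prop where
  hasSum_le : ∀ x : C₀(X, ℂ), ∃ s : C₀(X, ℂ),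
    HasSum (fun i => outerInner x (ξ i) * star (outerInner x (ξ i))) s ∧
      s ≤ inner C₀(X, ℂ) x x
  norm_le_one : ∀ i, ‖ξ i‖ ≤ 1

open scoped ENNReal in
/-- The pseudometric `d_{ξ,φ}(x, y) = (sup_k ∑_{i ≥ k} |φ_k(⟨x - y, ξᵢ⟩)|²)^{1/2}`. -/
def admDist (ξ : ℕ → X →ᵇ ℂ) (φ : ℕ → C₀(X, ℂ) →L[ℂ] ℂ) (x y : C₀(X, ℂ)) : ℝ≥0∞ :=
  (⨆ k : ℕ, ∑' j : ℕ, ‖φ k (outerInner (x - y) (ξ (k + j)))‖ₑ ^ 2) ^ (1 / 2 : ℝ)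

/-- `Y ⊆ C₀(X)` is totally bounded for the uniform structure given by all the pseudometrics
`d_{ξ,φ}`, with `φ` a sequence of states on `C₀(X)` and `ξ` an admissible sequence with members in
`V`. For `V = C_b(X)` this is `(C_b(X), C₀(X))`-total boundedness (outer admissible systems), for
`V = C₀(X)` it is `(C₀(X), C₀(X))`-total boundedness. -/
def IsTroitskyTotallyBounded (V : Set (X →ᵇ ℂ)) (Y : Set C₀(X, ℂ)) : Prop :=
  ∀ ξ : ℕ → X →ᵇ ℂ, IsAdmissible ξ → (∀ i, ξ i ∈ V) →
    ∀ φ : ℕ → C₀(X, ℂ) →L[ℂ] ℂ, (∀ k, IsState (φ k)) →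
      ∀ ε : ℝ, 0 < ε → ∃ t : Finset C₀(X, ℂ), (t : Set C₀(X, ℂ)) ⊆ Y ∧
        ∀ y ∈ Y, ∃ z ∈ t, admDist ξ φ z y < ENNReal.ofReal ε

end Uniform

/-- Troitsky's criterion for the Hilbert `C₀(X)`-module `C₀(X)`: an adjointable operator `F` from a
Hilbert `C₀(X)`-module `M` to `C₀(X)` is `C₀(X)`-compact if and only if the image of the unit ball
of `M` is totally bounded. -/
def TroitskyCriterion (X : Type u) [TopologicalSpace X] (V : Set (X →ᵇ ℂ)) : Prop :=
  ∀ (M : Type u) [NormedAddCommGroup M] [NormedSpace ℂ M] [CompleteSpace M] [SMul C₀(X, ℂ) M]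
    [CStarModule C₀(X, ℂ) M] (F : M →L[ℂ] C₀(X, ℂ)), IsAdjointable C₀(X, ℂ) F →
      (IsACompact C₀(X, ℂ) F ↔
        IsTroitskyTotallyBounded V (F '' Metric.closedBall (0 : M) 1))

end

/-! Countably many continuous functions on the deleted plank are independent of the first coordinate
near `p_∞`: each deviates from its value at `(p_∞, n)` only on a σ-compact subset of `P`, and such
sets stay away from `p_∞` (`IsKIV.exists_isCompact_forall_eq`). So all values of an admissible
sequence occur, simultaneously, on one compact set `T`. Admissibility tested on a function equal to
one on `T` makes `∑ |ξᵢ|²` converge uniformly (`IsAdmissible.exists_tail_le`). The tails of the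
pseudometrics are then uniformly small, finitely many coordinates remain, and the unit ball is
totally bounded (`exists_finset_admDist_lt`). The identity is not compact because compact operators
are limits of multiplications by functions vanishing at infinity, while the plank is not compact. -/

/-! ### Uniform convergence of `∑ |ξᵢ|²` and total boundedness of the unit ball. -/

section SumBounds

variable {X : Type u} [TopologicalSpace X]

theorem zeroAtInfty_sum_apply {ι : Type*} (s : Finset ι) (a : ι → C₀(X, ℂ)) (t : X) :
    (∑ i ∈ s, a i) t = ∑ i ∈ s, a i t := by
  classical
  induction s using Finset.induction_on with
  | empty => simp
  | insert i s hi ih => rw [Finset.sum_insert hi, Finset.sum_insert hi, ← ih]; rfl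

/-- A functional of norm at most one satisfies `∑ |φ(aᵢ)|² ≤ sup_t ∑ |aᵢ(t)|²`. -/
theorem sum_norm_sq_apply_le {ι : Type*} (φ : C₀(X, ℂ) →L[ℂ] ℂ) (hφ : ‖φ‖ ≤ 1) (s : Finset ι)
    (a : ι → C₀(X, ℂ)) {c : ℝ} (hc : 0 ≤ c) (h : ∀ t, ∑ i ∈ s, ‖a i t‖ ^ 2 ≤ c) :
    ∑ i ∈ s, ‖φ (a i)‖ ^ 2 ≤ c := by
  set S := ∑ i ∈ s, ‖φ (a i)‖ ^ 2 with hS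
  have hS0 : 0 ≤ S := Finset.sum_nonneg fun i _ => by positivity
  -- Duality: `φ b = S`, while Cauchy–Schwarz at each point bounds `‖b‖` by `√S * √c`.
  set b : C₀(X, ℂ) := ∑ i ∈ s, (star (φ (a i))) • a i with hb
  have hφb : φ b = (S : ℂ) := by
    rw [hb, map_sum, hS, Complex.ofReal_sum]
    refine Finset.sum_congr rfl fun i _ => ?_
    rw [map_smul, smul_eq_mul, Complex.star_def, mul_comm, Complex.mul_conj,
      Complex.normSq_eq_norm_sq]
  have hbnorm : ‖b‖ ≤ √S * √c := by
    rw [← ZeroAtInftyContinuousMap.norm_toBCF_eq_norm]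
    refine (BoundedContinuousFunction.norm_le (by positivity)).2 fun t => ?_
    have hbt : b.toBCF t = ∑ i ∈ s, star (φ (a i)) * a i t := by
      change b t = _
      rw [hb, zeroAtInfty_sum_apply]
      rfl
    rw [hbt]
    calc ‖∑ i ∈ s, star (φ (a i)) * a i t‖ ≤ ∑ i ∈ s, ‖φ (a i)‖ * ‖a i t‖ := by
          refine (norm_sum_le _ _).trans (Finset.sum_le_sum fun i _ => ?_)
          rw [norm_mul, norm_star]
      _ ≤ √(∑ i ∈ s, ‖φ (a i)‖ ^ 2) * √(∑ i ∈ s, ‖a i t‖ ^ 2) :=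
          Real.sum_mul_le_sqrt_mul_sqrt _ _ _
      _ ≤ √S * √c := by gcongr; exact h t
  have h1 : S ≤ √S * √c := by
    calc S = ‖φ b‖ := by rw [hφb, Complex.norm_real, Real.norm_of_nonneg hS0]
      _ ≤ ‖φ‖ * ‖b‖ := φ.le_opNorm b
      _ ≤ 1 * ‖b‖ := by gcongr
      _ ≤ √S * √c := by rw [one_mul]; exact hbnorm
  have h2 := Real.sq_sqrt hS0
  have h3 := Real.sq_sqrt hc
  -- `S ≤ √S * √c ≤ (S + c) / 2`, which avoids dividing by a possibly zero `√S`.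
  nlinarith [Real.sqrt_nonneg S, Real.sqrt_nonneg c, sq_nonneg (√S - √c)]

theorem outerInner_apply (x : C₀(X, ℂ)) (y : X →ᵇ ℂ) (t : X) :
    outerInner x y t = y t * star (x t) := rfl

theorem outerInner_sub (x x' : C₀(X, ℂ)) (y : X →ᵇ ℂ) :
    outerInner (x - x') y = outerInner x y - outerInner x' y := by
  ext t
  simp [outerInner_apply, mul_sub]

theorem norm_zeroAtInfty_apply_le (x : C₀(X, ℂ)) (t : X) : ‖x t‖ ≤ ‖x‖ := by
  rw [← ZeroAtInftyContinuousMap.norm_toBCF_eq_norm]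
  exact x.toBCF.norm_coe_le_norm t

theorem norm_outerInner_le (x : C₀(X, ℂ)) (y : X →ᵇ ℂ) : ‖outerInner x y‖ ≤ ‖y‖ * ‖x‖ := by
  rw [← ZeroAtInftyContinuousMap.norm_toBCF_eq_norm]
  refine (BoundedContinuousFunction.norm_le (by positivity)).2 fun t => ?_
  change ‖y t * star (x t)‖ ≤ _
  rw [norm_mul, norm_star]
  exact mul_le_mul (y.norm_coe_le_norm t) (norm_zeroAtInfty_apply_le x t) (norm_nonneg _)
    (norm_nonneg _)

/-- In a locally compact Hausdorff space, some function in the unit ball of `C₀(X)` is equal to one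
on a given compact set. -/
theorem exists_zeroAtInfty_eqOn_one [T2Space X] [LocallyCompactSpace X] {T : Set X}
    (hT : IsCompact T) : ∃ h : C₀(X, ℂ), (∀ t ∈ T, h t = 1) ∧ ‖h‖ ≤ 1 := by
  obtain ⟨f, hf1, -, hfc, hf01⟩ :=
    exists_continuous_one_zero_of_isCompact hT isClosed_empty (Set.disjoint_empty T)
  refine ⟨⟨⟨fun t => ((f t : ℝ) : ℂ), by fun_prop⟩, ?_⟩, fun t ht => ?_, ?_⟩
  · have : HasCompactSupport fun t => ((f t : ℝ) : ℂ) :=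
      hfc.comp_left (g := fun r : ℝ => (r : ℂ)) Complex.ofReal_zero
    exact this.is_zero_at_infty
  · change ((f t : ℝ) : ℂ) = 1
    rw [hf1 ht]
    simp
  · rw [← ZeroAtInftyContinuousMap.norm_toBCF_eq_norm]
    refine (BoundedContinuousFunction.norm_le zero_le_one).2 fun t => ?_
    change ‖((f t : ℝ) : ℂ)‖ ≤ 1
    rw [Complex.norm_real, Real.norm_of_nonneg (hf01 t).1]
    exact (hf01 t).2

/-- If the values of the `ξᵢ` on `X` are already attained, simultaneously, on a compact set, then
the series `∑ |ξᵢ|²` of an admissible sequence converges uniformly on `X`. -/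
theorem IsAdmissible.exists_tail_le [T2Space X] [LocallyCompactSpace X] {ξ : ℕ → X →ᵇ ℂ}
    (hξ : IsAdmissible ξ) {T : Set X} (hT : IsCompact T)
    (hrep : ∀ t, ∃ t' ∈ T, ∀ i, ξ i t = ξ i t') {η : ℝ} (hη : 0 < η) :
    ∃ n : ℕ, ∀ s : Finset ℕ, (∀ i ∈ s, n ≤ i) → ∀ t, ∑ i ∈ s, ‖ξ i t‖ ^ 2 ≤ η := by
  obtain ⟨h, h1, -⟩ := exists_zeroAtInfty_eqOn_one hT
  obtain ⟨S, hS, -⟩ := hξ.hasSum_le h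
  obtain ⟨u, hu⟩ := summable_iff_vanishing_norm.1 hS.summable η hη
  refine ⟨u.sup id + 1, fun s hs t => ?_⟩
  have hdisj : Disjoint s u := Finset.disjoint_left.2 fun i hi hiu => by
    have := hs i hi
    have : i ≤ u.sup id := Finset.le_sup (f := id) hiu
    omega
  obtain ⟨t', ht', hval⟩ := hrep t
  have h2 := (norm_zeroAtInfty_apply_le _ t').trans (hu s hdisj).le
  have h3 : (∑ i ∈ s, outerInner h (ξ i) * star (outerInner h (ξ i))) t'
      = ((∑ i ∈ s, ‖ξ i t‖ ^ 2 : ℝ) : ℂ) := by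
    rw [zeroAtInfty_sum_apply, Complex.ofReal_sum]
    refine Finset.sum_congr rfl fun i _ => ?_
    change (ξ i t' * star (h t')) * star (ξ i t' * star (h t')) = _
    rw [h1 t' ht', star_one, mul_one, ← hval i, Complex.star_def, Complex.mul_conj,
      Complex.normSq_eq_norm_sq]
  rw [h3, Complex.norm_real] at h2
  exact (le_abs_self _).trans h2

/-- If the series `∑ |ξᵢ|²` converges uniformly, then the unit ball of `C₀(X)` is totally bounded
for every pseudometric `d_{ξ,φ}`. -/
theorem exists_finset_admDist_lt {ξ : ℕ → X →ᵇ ℂ} (hξ : ∀ i, ‖ξ i‖ ≤ 1)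
    (htail : ∀ η : ℝ, 0 < η →
      ∃ n : ℕ, ∀ s : Finset ℕ, (∀ i ∈ s, n ≤ i) → ∀ t, ∑ i ∈ s, ‖ξ i t‖ ^ 2 ≤ η)
    {φ : ℕ → C₀(X, ℂ) →L[ℂ] ℂ} (hφ : ∀ k, ‖φ k‖ ≤ 1) {ε : ℝ} (hε : 0 < ε) :
    ∃ t : Finset C₀(X, ℂ), (t : Set C₀(X, ℂ)) ⊆ Metric.closedBall 0 1 ∧
      ∀ y ∈ Metric.closedBall (0 : C₀(X, ℂ)) 1, ∃ z ∈ t, admDist ξ φ z y < ENNReal.ofReal ε := by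
  classical
  -- Two points of the unit ball differ by at most 2 in norm, so the tail costs at most `4 * ε ^ 2 /
  -- 16`.
  obtain ⟨n, hn⟩ := htail (ε ^ 2 / 16) (by positivity)
  -- The `k`-th sum starts at `i = k`, so head terms `i < n` occur only for `k < n`: finitely many
  -- numbers control all heads.
  set L : C₀(X, ℂ) → (Fin n × Fin n → ℂ) := fun z q => φ q.1 (outerInner z (ξ q.2)) with hL
  set B := Metric.closedBall (0 : C₀(X, ℂ)) 1 with hB
  have hbdd : TotallyBounded (L '' B) := by
    refine (isCompact_closedBall (0 : Fin n × Fin n → ℂ) 1).totallyBounded.subset ?_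
    rintro _ ⟨z, hz, rfl⟩
    rw [hB, mem_closedBall_zero_iff] at hz
    rw [mem_closedBall_zero_iff, pi_norm_le_iff_of_nonneg zero_le_one]
    intro q
    calc ‖φ q.1 (outerInner z (ξ q.2))‖ ≤ ‖φ q.1‖ * ‖outerInner z (ξ q.2)‖ := (φ q.1).le_opNorm _
      _ ≤ 1 * (1 * 1) := by
        gcongr
        · exact hφ _
        · exact (norm_outerInner_le _ _).trans (by gcongr; exact hξ _)
      _ = 1 := by norm_num
  -- Chosen so that at most `n` head terms, each at most `δ ^ 2`, add up to at most `ε ^ 2 / 4`.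
  set δ : ℝ := ε / (2 * (n + 1)) with hδ
  have hδ0 : 0 < δ := by positivity
  obtain ⟨F, hFsub, hFfin, hFcov⟩ := Metric.finite_approx_of_totallyBounded hbdd δ hδ0
  choose! g hgB hgL using fun v (hv : v ∈ F) => hFsub hv
  refine ⟨hFfin.toFinset.image g, ?_, fun y hy => ?_⟩
  · intro z hz
    obtain ⟨v, hv, rfl⟩ := Finset.mem_image.1 (Finset.mem_coe.1 hz)
    exact hgB v (hFfin.mem_toFinset.1 hv)
  obtain ⟨v, hv, hyv⟩ := Set.mem_iUnion₂.1 (hFcov ⟨y, hy, rfl⟩)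
  refine ⟨g v, Finset.mem_image_of_mem _ (hFfin.mem_toFinset.2 hv), ?_⟩
  have hz := hgB v hv
  rw [← hgL v hv] at hyv
  set z := g v
  rw [hB, mem_closedBall_zero_iff] at hz hy
  have hzy : ‖z - y‖ ≤ 2 := (norm_sub_le _ _).trans (by linarith)
  set a : ℕ → C₀(X, ℂ) := fun i => outerInner (z - y) (ξ i) with ha
  have hhead : ∀ k < n, ∀ i < n, ‖φ k (a i)‖ ^ 2 ≤ δ ^ 2 := by
    intro k hk i hi
    have h1 : dist (L y (⟨k, hk⟩, ⟨i, hi⟩)) (L z (⟨k, hk⟩, ⟨i, hi⟩)) < δ :=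
      (dist_le_pi_dist _ _ _).trans_lt hyv
    have h2 : φ k (a i) = L z (⟨k, hk⟩, ⟨i, hi⟩) - L y (⟨k, hk⟩, ⟨i, hi⟩) := by
      simp only [ha, hL, outerInner_sub, map_sub]
    rw [dist_comm, dist_eq_norm, ← h2] at h1
    gcongr
  have htl : ∀ k, ∀ s : Finset ℕ, (∀ i ∈ s, n ≤ i) → ∑ i ∈ s, ‖φ k (a i)‖ ^ 2 ≤ ε ^ 2 / 4 := by
    intro k s hs
    refine sum_norm_sq_apply_le (φ k) (hφ k) s a (by positivity) fun p => ?_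
    calc ∑ i ∈ s, ‖a i p‖ ^ 2 ≤ ∑ i ∈ s, 4 * ‖ξ i p‖ ^ 2 := by
          refine Finset.sum_le_sum fun i _ => ?_
          rw [ha, outerInner_apply, norm_mul, norm_star, mul_pow, mul_comm]
          gcongr
          have := (norm_zeroAtInfty_apply_le (z - y) p).trans hzy
          nlinarith [norm_nonneg ((z - y) p)]
      _ = 4 * ∑ i ∈ s, ‖ξ i p‖ ^ 2 := by rw [Finset.mul_sum]
      _ ≤ ε ^ 2 / 4 := by linarith [hn s hs p]
  have hnδ : n * δ ^ 2 ≤ ε ^ 2 / 4 := by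
    have : n * δ ^ 2 = ε ^ 2 / 4 * (n / (n + 1) ^ 2) := by rw [hδ]; field_simp; ring
    rw [this]
    refine mul_le_of_le_one_right (by positivity) ((div_le_one (by positivity)).2 ?_)
    nlinarith [(Nat.cast_nonneg n : (0 : ℝ) ≤ n)]
  have hreal : ∀ k, ∀ s : Finset ℕ, (∀ i ∈ s, k ≤ i) →
      ∑ i ∈ s, ‖φ k (a i)‖ ^ 2 ≤ ε ^ 2 / 2 := by
    intro k s hs
    rw [← Finset.sum_filter_add_sum_filter_not s (fun i => i < n)]
    have h1 : ∑ i ∈ s with i < n, ‖φ k (a i)‖ ^ 2 ≤ ε ^ 2 / 4 := by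
      refine le_trans ?_ hnδ
      calc ∑ i ∈ s with i < n, ‖φ k (a i)‖ ^ 2 ≤ ∑ i ∈ s with i < n, δ ^ 2 := by
            refine Finset.sum_le_sum fun i hi => ?_
            obtain ⟨his, hin⟩ := Finset.mem_filter.1 hi
            exact hhead k ((hs i his).trans_lt hin) i hin
        _ = (s.filter fun i => i < n).card * δ ^ 2 := by rw [Finset.sum_const, nsmul_eq_mul]
        _ ≤ n * δ ^ 2 := by
            gcongr
            calc (s.filter fun i => i < n).card ≤ (Finset.range n).card :=
                  Finset.card_le_card fun i hi =>
                    Finset.mem_range.2 (Finset.mem_filter.1 hi).2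
              _ = n := Finset.card_range n
    have h2 := htl k (s.filter fun i => ¬ i < n) fun i hi => not_lt.1 (Finset.mem_filter.1 hi).2
    linarith
  have hsup : (⨆ k : ℕ, ∑' j : ℕ, ‖φ k (outerInner (z - y) (ξ (k + j)))‖ₑ ^ 2)
      ≤ ENNReal.ofReal (ε ^ 2 / 2) := by
    refine iSup_le fun k => ?_
    rw [ENNReal.tsum_eq_iSup_sum]
    refine iSup_le fun s => ?_
    have h1 : ∑ j ∈ s, ‖φ k (a (k + j))‖ ^ 2 ≤ ε ^ 2 / 2 := by
      have := hreal k (s.map (addLeftEmbedding k)) (by simp)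
      simpa using this
    calc ∑ j ∈ s, ‖φ k (a (k + j))‖ₑ ^ 2
        = ENNReal.ofReal (∑ j ∈ s, ‖φ k (a (k + j))‖ ^ 2) := by
          rw [ENNReal.ofReal_sum_of_nonneg fun _ _ => by positivity]
          refine Finset.sum_congr rfl fun j _ => ?_
          rw [ENNReal.ofReal_pow (norm_nonneg _), ofReal_norm]
      _ ≤ _ := ENNReal.ofReal_le_ofReal h1
  calc admDist ξ φ z y ≤ ENNReal.ofReal (ε ^ 2 / 2) ^ (1 / 2 : ℝ) :=
        ENNReal.rpow_le_rpow hsup (by norm_num)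
    _ < ENNReal.ofReal (ε ^ 2) ^ (1 / 2 : ℝ) := by
        refine ENNReal.rpow_lt_rpow ?_ (by norm_num)
        exact (ENNReal.ofReal_lt_ofReal_iff (by positivity)).2 (by nlinarith)
    _ = ENNReal.ofReal ε := by
        rw [ENNReal.ofReal_rpow_of_nonneg (by positivity) (by norm_num), ← Real.sqrt_eq_rpow,
          Real.sqrt_sq hε.le]

end SumBounds

/-! ### Compact operators on `C₀(X)` as limits of multiplications. -/

section Compactness

variable {X : Type u} [TopologicalSpace X]

/-- The operators in the span of the elementary compact ones are multiplications by elements of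
`C₀(X)`. -/
theorem exists_eq_mul_of_mem_span_elementaryCompact {θ : C₀(X, ℂ) →L[ℂ] C₀(X, ℂ)}
    (hθ : θ ∈ Submodule.span ℂ (elementaryCompact C₀(X, ℂ) C₀(X, ℂ) C₀(X, ℂ))) :
    ∃ h : C₀(X, ℂ), ∀ z, θ z = h * z := by
  induction hθ using Submodule.span_induction with
  | mem θ hθ =>
    obtain ⟨x, y, hxy⟩ := hθ
    refine ⟨star y * x, fun z => ?_⟩
    rw [hxy]
    ext t
    change (z t * star (y t)) * x t = (star (y t) * x t) * z t
    ring
  | zero => exact ⟨0, fun z => by simp⟩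
  | add θ₁ θ₂ _ _ h₁ h₂ =>
    obtain ⟨a, ha⟩ := h₁
    obtain ⟨b, hb⟩ := h₂
    exact ⟨a + b, fun z => by rw [add_apply, ha, hb, add_mul]⟩
  | smul c θ _ h =>
    obtain ⟨a, ha⟩ := h
    exact ⟨c • a, fun z => by rw [smul_apply, ha, smul_mul_assoc]⟩

/-- If `X` is not compact, the identity of the Hilbert `C₀(X)`-module `C₀(X)` is not
`C₀(X)`-compact. -/
theorem not_isACompact_id [T2Space X] [LocallyCompactSpace X] [NoncompactSpace X] :
    ¬ IsACompact C₀(X, ℂ) (ContinuousLinearMap.id ℂ C₀(X, ℂ)) := by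
  intro hid
  obtain ⟨θ, hθ, hdist⟩ := Metric.mem_closure_iff.1 hid (1 / 2) (by norm_num)
  obtain ⟨h, hh⟩ := exists_eq_mul_of_mem_span_elementaryCompact hθ
  have hsmall : ∀ᶠ t in Filter.cocompact X, ‖h t‖ < 1 / 2 := by
    have := h.zero_at_infty'.norm
    rw [norm_zero] at this
    exact this.eventually_lt_const (by norm_num)
  -- Noncompactness enters here: the filter `cocompact X` is nontrivial.
  obtain ⟨t, ht⟩ := hsmall.exists
  obtain ⟨z, hz1, hz⟩ := exists_zeroAtInfty_eqOn_one (isCompact_singleton (x := t))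
  have h1 : ‖(ContinuousLinearMap.id ℂ C₀(X, ℂ) - θ) z‖ ≤ 1 / 2 := by
    rw [dist_eq_norm] at hdist
    calc _ ≤ ‖ContinuousLinearMap.id ℂ C₀(X, ℂ) - θ‖ * ‖z‖ := ContinuousLinearMap.le_opNorm _ _
      _ ≤ 1 / 2 * 1 := by gcongr
      _ = 1 / 2 := by norm_num
  have h2 := (norm_zeroAtInfty_apply_le _ t).trans h1
  have h3 : ((ContinuousLinearMap.id ℂ C₀(X, ℂ) - θ) z) t = 1 - h t := by
    rw [sub_apply, hh]
    change z t - h t * z t = _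
    rw [hz1 t rfl, mul_one]
  rw [h3] at h2
  have h4 : ‖(1 : ℂ)‖ ≤ ‖1 - h t‖ + ‖h t‖ := by
    simpa using norm_add_le (1 - h t) (h t)
  rw [norm_one] at h4
  linarith

/-- Troitsky's criterion fails for `C₀(X)` if the unit ball is totally bounded and the identity is
not compact. -/
theorem not_troitskyCriterion {V : Set (X →ᵇ ℂ)}
    (htb : IsTroitskyTotallyBounded V (Metric.closedBall (0 : C₀(X, ℂ)) 1))
    (hid : ¬ IsACompact C₀(X, ℂ) (ContinuousLinearMap.id ℂ C₀(X, ℂ))) :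
    ¬ TroitskyCriterion X V := by
  intro hcrit
  refine hid ((hcrit C₀(X, ℂ) (ContinuousLinearMap.id ℂ C₀(X, ℂ))
    ⟨ContinuousLinearMap.id ℂ C₀(X, ℂ), fun x y => rfl⟩).2 ?_)
  simpa using htb

end Compactness

/-! ### Topology of the deleted plank. -/

section Plank

variable {P : Type u} [TopologicalSpace P]

theorem IsKIV.t2Space_onePoint (hP : IsKIV P) : T2Space (OnePoint P) := by
  have := hP.locallyCompact
  have := hP.t2
  infer_instance

theorem IsKIV.locallyCompactSpace_deletedPlank (hP : IsKIV P) :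
    LocallyCompactSpace (DeletedPlank P) := by
  have := hP.t2Space_onePoint
  exact (isOpen_ne (x := ((OnePoint.infty, ⊤) : OnePoint P × ℕ∞))).isOpenEmbedding_subtypeVal
    |>.locallyCompactSpace

/-- The points `(p_∞, n)` converge to the deleted corner, so the plank is not closed in the product.
-/
theorem IsKIV.noncompactSpace_deletedPlank (hP : IsKIV P) : NoncompactSpace (DeletedPlank P) := by
  have := hP.t2Space_onePoint
  refine not_compactSpace_iff.1 fun hc => ?_
  have hclosed : IsClosed {q : OnePoint P × ℕ∞ | q ≠ (OnePoint.infty, ⊤)} :=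
    (isCompact_iff_compactSpace.2 hc).isClosed
  have hlim : Filter.Tendsto (fun n : ℕ => ((OnePoint.infty, (n : ℕ∞)) : OnePoint P × ℕ∞))
      Filter.atTop (nhds (OnePoint.infty, ⊤)) :=
    tendsto_const_nhds.prodMk_nhds ENat.tendsto_natCast_nhds_top
  exact hclosed.mem_of_tendsto hlim (Filter.Eventually.of_forall fun n => by simp) rfl

/-- Near the edge `{p_∞} × [0, ω₀)` countably many continuous functions on the deleted plank do not
depend on the first coordinate; hence all their values are simultaneously attained on some compact
set. -/
theorem IsKIV.exists_isCompact_forall_eq (hP : IsKIV P) (f : ℕ → DeletedPlank P → ℂ)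
    (hf : ∀ i, Continuous (f i)) :
    ∃ T : Set (DeletedPlank P), IsCompact T ∧ ∀ t, ∃ t' ∈ T, ∀ i, f i t = f i t' := by
  have hfin : ∀ (p : OnePoint P) (n : ℕ), (p, (n : ℕ∞)) ≠ (OnePoint.infty, ⊤) := by simp
  have htop : ∀ (p : P) (m : ℕ∞), ((p : OnePoint P), m) ≠ (OnePoint.infty, ⊤) := by simp
  set g : ℕ → ℕ → OnePoint P → ℂ := fun i n p => f i ⟨(p, n), hfin p n⟩ with hg
  have hgc : ∀ i n, Continuous (g i n) := fun i n => (hf i).comp (by fun_prop)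
  set C : ℕ × ℕ × ℕ → Set P :=
    fun q => {p | 1 / ((q.2.2 : ℝ) + 1) ≤ dist (g q.1 q.2.1 p) (g q.1 q.2.1 OnePoint.infty)}
    with hC
  have hCcomp : ∀ q, IsCompact (C q) := by
    intro q
    have hcl : IsClosed {p : OnePoint P |
        1 / ((q.2.2 : ℝ) + 1) ≤ dist (g q.1 q.2.1 p) (g q.1 q.2.1 OnePoint.infty)} :=
      isClosed_le continuous_const ((hgc _ _).dist continuous_const)
    have hninf : (OnePoint.infty : OnePoint P) ∉ {p : OnePoint P |
        1 / ((q.2.2 : ℝ) + 1) ≤ dist (g q.1 q.2.1 p) (g q.1 q.2.1 OnePoint.infty)} := by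
      simp only [Set.mem_ofPred_eq, dist_self, not_le]
      positivity
    exact ((OnePoint.isClosed_iff_of_notMem hninf).1 hcl).2
  have hσ : IsSigmaCompact (⋃ q, C q) := isSigmaCompact_iUnion_of_isCompact _ hCcomp
  obtain ⟨U, hUsub, hUo, hUinf⟩ := mem_interior.1 (hP.infty_mem_interior_compl _ hσ)
  have hQ : IsCompact (((↑) : P → OnePoint P) ⁻¹' U)ᶜ := ((OnePoint.isOpen_iff_of_mem hUinf).1 hUo).2
  -- `p₀` is a finite point of `U`; the line over it will represent all lines over points of `U`,
  -- including `p_∞`.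
  obtain ⟨p₀, hp₀⟩ := hP.nonempty_interior_compl _ hQ.isSigmaCompact
  have hp₀U : (p₀ : OnePoint P) ∈ U := by
    simpa using interior_subset hp₀
  have hconst : ∀ p ∈ U, ∀ i n, g i n p = g i n OnePoint.infty := by
    intro p hp i n
    induction p using OnePoint.rec with
    | infty => rfl
    | coe p =>
      by_contra hne
      obtain ⟨m, hm⟩ := exists_nat_one_div_lt (dist_pos.2 hne)
      exact hUsub hp ⟨p, Set.mem_iUnion.2 ⟨(i, n, m), hm.le⟩, rfl⟩
  set e : P × ℕ∞ → DeletedPlank P := fun q => ⟨((q.1 : OnePoint P), q.2), htop q.1 q.2⟩ with he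
  have hec : Continuous e :=
    ((OnePoint.continuous_coe.comp continuous_fst).prodMk continuous_snd).subtype_mk _
  refine ⟨e '' ((insert p₀ (((↑) : P → OnePoint P) ⁻¹' U)ᶜ) ×ˢ Set.univ),
    ((hQ.insert p₀).prod isCompact_univ).image hec, ?_⟩
  rintro ⟨⟨p, m⟩, hpm⟩
  by_cases hp : p ∈ U
  · refine ⟨e (p₀, m), ⟨_, ⟨Set.mem_insert _ _, trivial⟩, rfl⟩, fun i => ?_⟩
    have hnat : ∀ n : ℕ, g i n p = g i n p₀ := fun n =>
      (hconst p hp i n).trans (hconst p₀ hp₀U i n).symm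
    -- On the top edge the corner is absent, so values at `(p, ⊤)` and `(p₀, ⊤)` are compared as
    -- limits along `n`.
    induction m using ENat.recTopCoe with
    | coe n => exact hnat n
    | top =>
      induction p using OnePoint.rec with
      | infty => exact absurd rfl hpm
      | coe p =>
        have hlim : ∀ r : P, Filter.Tendsto (fun n : ℕ => f i (e (r, n))) Filter.atTop
            (nhds (f i (e (r, ⊤)))) := fun r =>
          (((hf i).comp hec).tendsto (r, ⊤)).comp
            (tendsto_const_nhds.prodMk_nhds ENat.tendsto_natCast_nhds_top)
        exact tendsto_nhds_unique (hlim p) ((hlim p₀).congr fun n => (hnat n).symm)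
  · induction p using OnePoint.rec with
    | infty => exact absurd hUinf hp
    | coe p => exact ⟨e (p, m), ⟨(p, m), ⟨Or.inr hp, trivial⟩, rfl⟩, fun i => rfl⟩

end Plank

theorem mainTheorem5 (P : Type u) [TopologicalSpace P] (hP : IsKIV P) :
    IsTroitskyTotallyBounded Set.univ
        (Metric.closedBall (0 : C₀(DeletedPlank P, ℂ)) 1) ∧
      ¬ IsACompact C₀(DeletedPlank P, ℂ)
          (ContinuousLinearMap.id ℂ C₀(DeletedPlank P, ℂ)) ∧
      ¬ TroitskyCriterion (DeletedPlank P) Set.univ ∧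
      ¬ TroitskyCriterion (DeletedPlank P)
          (Set.range (ZeroAtInftyContinuousMap.toBCF : C₀(DeletedPlank P, ℂ) → _)) := by
  have := hP.t2Space_onePoint
  have := hP.locallyCompactSpace_deletedPlank
  have := hP.noncompactSpace_deletedPlank
  have htb : IsTroitskyTotallyBounded Set.univ
      (Metric.closedBall (0 : C₀(DeletedPlank P, ℂ)) 1) := by
    intro ξ hξ _ φ hφ ε hε
    obtain ⟨T, hT, hrep⟩ := hP.exists_isCompact_forall_eq (fun i => ξ i) fun i => (ξ i).continuous
    exact exists_finset_admDist_lt hξ.norm_le_one (fun η hη => hξ.exists_tail_le hT hrep hη)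
      (fun k => (hφ k).norm_eq_one.le) hε
  exact ⟨htb, not_isACompact_id, not_troitskyCriterion htb not_isACompact_id,
    not_troitskyCriterion (fun ξ hξ _ => htb ξ hξ fun _ => Set.mem_univ _) not_isACompact_id⟩
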